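/- Let $H$ be a finite-dimensional complex Hilbert space and $\|\cdot\|$ the operator norm. A Hamiltonian on $[0,T]$ is an integrable family $(V_t)_{t\in[0,T]}$ of self-adjoint operators; its propagator $U_t=\mathrm{Texp}\left(-i\int_0^t V_s\,ds\right)$ is the continuous solution of $U_t=1-i\int_0^t V_sU_s\,ds$ on $[0,T]$. For density operators $\rho,\sigma$ with the same spectrum (with multiplicities), the quantum charging distance is $$D(\rho,\sigma)=\min\left\{T\ge 0:\ \sigma=U_T\,\rho\,U_T^\dagger \text{ for the propagator } U \text{ of some Hamiltonian } V \text{ on } [0,T] \text{ with } \|V_t\|=1 \text{ for all } t\in[0,T]\right\}.$$ Let $\rho$ be a density operator on $H$, $T>0$, $V$ a Hamiltonian on $[0,T]$ with propagator $U$, $\rho_t=U_t\rho U_t^\dagger$ and $\sigma=\rho_T$. Put $$v_{CD}=\frac1T\int_0^T\|V_t\|\,dt,\qquad v_{mCD}=\frac1T\min_{D:\,[D_t,\rho_t]=0\ \forall t}\int_0^T\|V_t+D_t\|\,dt,$$ where the minimum is over all Hamiltonians $D$ on $[0,T]$ with $[D_t,\rho_t]=0$ for all $t\in[0,T]$. Let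 $t_{CD}=D(\rho,\sigma)/v_{CD}$ and $t_{mCD}=D(\rho,\sigma)/v_{mCD}$ (read as $0$ if the denominator vanishes). Then: 1. The minima defining $D(\rho,\sigma)$ and $v_{mCD}$ are attained. 2. $D(\rho,\sigma)\le T\,v_{mCD}=\min_{D:\,[D_t,\rho_t]=0}\int_0^T\|V_t+D_t\|\,dt$, and hence $t_{mCD}\le T$. 3. $D(\rho,\sigma)\le T\,v_{CD}=\int_0^T\|V_t\|\,dt$, and $t_{CD}\le t_{mCD}\le T$. 4. The bound $t_{CD}$ is achievable: for every $T'>0$ there is a Hamiltonian $V'$ on $[0,T']$ whose propagator takes $\rho$ to $\sigma$ in time $T'$ and for which $\int_0^{T'}\|V'_t\|\,dt=D(\rho,\sigma)$; if $\rho\ne\sigma$, then $t_{CD}=T'$ for this evolution. -/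

import Mathlib

noncomputable section

namespace QuantumCharging

open MeasureTheory Set

variable {H : Type*} [NormedAddCommGroup H] [InnerProductSpace ℂ H] [CompleteSpace H]

/-- Density operators: positive operators of trace one (on a finite-dimensional space). -/
structure IsDensity (ρ : H →L[ℂ] H) : Prop where
  pos : ρ.IsPositive
  trace_one : LinearMap.trace ℂ H (ρ : H →ₗ[ℂ] H) = 1

/-- A time-dependent Hamiltonian on `[0, T]`: self-adjoint at every time and integrable in time. -/
structure IsHamiltonian (T : ℝ) (V : ℝ → H →L[ℂ] H) : Prop where
  selfAdjoint : ∀ t ∈ Icc 0 T, IsSelfAdjoint (V t)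
  integrable : IntervalIntegrable V volume 0 T

/-- `U t = Texp (-i ∫₀ᵗ V_s ds)` for `t ∈ [0, T]`: the time-ordered exponential is the continuous
solution of the Schrödinger equation `U' = -i V U`, `U 0 = 1`, in integral form. -/
structure IsPropagator (T : ℝ) (V U : ℝ → H →L[ℂ] H) : Prop where
  continuousOn : ContinuousOn U (Icc 0 T)
  schrodinger : ∀ t ∈ Icc 0 T, U t = 1 - Complex.I • ∫ s in (0 : ℝ)..t, V s * U s

/-- The state `ρ_t = U_t ρ U_t†`. -/
def state (U : ℝ → H →L[ℂ] H) (ρ : H →L[ℂ] H) (t : ℝ) : H →L[ℂ] H :=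
  U t * ρ * star (U t)

/-- The times `T` in which `ρ` can be driven to `σ` by a Hamiltonian with `‖V_t‖ = 1`
(operator norm) throughout. -/
def chargingTimes (ρ σ : H →L[ℂ] H) : Set ℝ :=
  {T | 0 ≤ T ∧ ∃ V U : ℝ → H →L[ℂ] H, IsHamiltonian T V ∧ (∀ t ∈ Icc 0 T, ‖V t‖ = 1) ∧
    IsPropagator T V U ∧ state U ρ T = σ}

/-- The quantum charging distance: the least charging time. -/
def chargingDistance (ρ σ : H →L[ℂ] H) : ℝ :=
  sInf (chargingTimes ρ σ)

/-- The values `∫₀ᵀ ‖V_t + D_t‖ dt`, over all time-dependent Hamiltonians `D` with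
`[D_t, ρ_t] = 0` for all `t`; here `r t` stands for `ρ_t`. -/
def modifiedCosts (T : ℝ) (V r : ℝ → H →L[ℂ] H) : Set ℝ :=
  {c | ∃ D : ℝ → H →L[ℂ] H, IsHamiltonian T D ∧ (∀ t ∈ Icc 0 T, Commute (D t) (r t)) ∧
    c = ∫ t in (0 : ℝ)..T, ‖V t + D t‖}

/-- The speed `v_CD`. -/
def vCD (T : ℝ) (V : ℝ → H →L[ℂ] H) : ℝ :=
  1 / T * ∫ t in (0 : ℝ)..T, ‖V t‖

/-- The modified speed `v_mCD`. -/
def vmCD (T : ℝ) (V r : ℝ → H →L[ℂ] H) : ℝ :=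
  1 / T * sInf (modifiedCosts T V r)

/-- The time `t_CD` for an evolution that starts in `ρ` and ends in `σ`. -/
def tCD (T : ℝ) (V : ℝ → H →L[ℂ] H) (ρ σ : H →L[ℂ] H) : ℝ :=
  chargingDistance ρ σ / vCD T V

/-- The time `t_mCD` for an evolution `r` that starts in `ρ` and ends in `σ`. -/
def tmCD (T : ℝ) (V r : ℝ → H →L[ℂ] H) (ρ σ : H →L[ℂ] H) : ℝ :=
  chargingDistance ρ σ / vmCD T V r

end QuantumCharging

end

/-!
A unitary is `exp (-iA)` with `A` self-adjoint and `‖A‖` the largest argument of an eigenvalue.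
Hence the charging distance is the least norm of an `A` with `exp (-iA) ρ exp (iA) = σ`: constant
Hamiltonians attain it. Conversely, if `U` is the propagator of `V` and `x` is a unit eigenvector of
`U T` with eigenvalue `exp (iθ)`, `|θ| ≤ π`, then `t ↦ U t x` is a curve on the real unit sphere of
`H` from `x` to `exp (iθ) x`; its length is at least the angle `|θ|` between its ends and at most
`∫ ‖V t‖`. So some generator has norm at most `∫ ‖V t‖`.

Adding to `V` a term that commutes with the state does not change the state, so the same bound holds
for all modified costs. In the frame that rotates with `U` the cost `‖V t + D t‖` is minimised over
one fixed subspace of corrections, and a measurable selection of the minimisers attains the least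
modified cost.
-/

noncomputable section

namespace QuantumCharging

open MeasureTheory Set Filter Topology

section AbsolutelyContinuous

variable {X Y : Type*} [PseudoMetricSpace X] [PseudoMetricSpace Y] {a b : ℝ}

theorem absolutelyContinuousOnInterval_of_dist_le {f : ℝ → X} {g : ℝ → Y} {C : ℝ}
    (hg : AbsolutelyContinuousOnInterval g a b)
    (h : ∀ x ∈ uIcc a b, ∀ y ∈ uIcc a b, dist (f x) (f y) ≤ C * dist (g x) (g y)) :
    AbsolutelyContinuousOnInterval f a b := by
  refine squeeze_zero' (.of_forall fun E => by positivity) ?_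
    (by simpa using Tendsto.const_mul C hg)
  filter_upwards [mem_inf_of_right (mem_principal_self _)] with E hE
  rw [Finset.mul_sum]
  exact Finset.sum_le_sum fun i hi => h _ (hE.1 i hi).1 _ (hE.1 i hi).2

theorem absolutelyContinuousOnInterval_prodMk {f : ℝ → X} {g : ℝ → Y}
    (hf : AbsolutelyContinuousOnInterval f a b) (hg : AbsolutelyContinuousOnInterval g a b) :
    AbsolutelyContinuousOnInterval (fun t => (f t, g t)) a b := by
  refine squeeze_zero (fun E => by positivity) (fun E => ?_) (by simpa using Tendsto.add hf hg)
  rw [← Finset.sum_add_distrib]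
  exact Finset.sum_le_sum fun i _ => max_le_add_of_nonneg dist_nonneg dist_nonneg

variable {E F : Type*} [NormedAddCommGroup E] [NormedSpace ℝ E] [NormedAddCommGroup F]
  [NormedSpace ℝ F] {f g : ℝ → E} {c : E}

theorem absolutelyContinuousOnInterval_contDiffAt_comp {φ : E → F}
    (hφ : ∀ t ∈ uIcc a b, ContDiffAt ℝ 1 φ (f t)) (hf : AbsolutelyContinuousOnInterval f a b) :
    AbsolutelyContinuousOnInterval (fun t => φ (f t)) a b := by
  have hlocal : LocallyLipschitzOn (f '' uIcc a b) φ := by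
    rintro _ ⟨t, ht, rfl⟩
    obtain ⟨K, s, hs, hK⟩ := (hφ t ht).exists_lipschitzOnWith
    exact ⟨K, s, mem_nhdsWithin_of_mem_nhds hs, hK⟩
  obtain ⟨K, hK⟩ :=
    hlocal.exists_lipschitzOnWith_of_compact (isCompact_uIcc.image_of_continuousOn hf.continuousOn)
  exact absolutelyContinuousOnInterval_of_dist_le hf fun x hx y hy =>
    hK.dist_le_mul _ (mem_image_of_mem f hx) _ (mem_image_of_mem f hy)

theorem absolutelyContinuousOnInterval_mul {A : Type*} [NormedRing A] [NormedAlgebra ℝ A]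
    {f g : ℝ → A} (hf : AbsolutelyContinuousOnInterval f a b)
    (hg : AbsolutelyContinuousOnInterval g a b) :
    AbsolutelyContinuousOnInterval (fun t => f t * g t) a b := by
  have hpair := absolutelyContinuousOnInterval_prodMk hf hg
  exact absolutelyContinuousOnInterval_contDiffAt_comp (φ := fun p : A × A => p.1 * p.2)
    (f := fun t => (f t, g t)) (fun _ _ => contDiff_mul.contDiffAt) hpair

theorem absolutelyContinuousOnInterval_of_eq_add_integral (hg : IntervalIntegrable g volume a b)
    (hf : ∀ t ∈ uIcc a b, f t = c + ∫ s in a..t, g s) : AbsolutelyContinuousOnInterval f a b := by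
  refine absolutelyContinuousOnInterval_of_dist_le (C := 1)
    (hg.norm.absolutelyContinuousOnInterval_intervalIntegral left_mem_uIcc) fun x hx y hy => ?_
  have hint {z : ℝ} (hz : z ∈ uIcc a b) : IntervalIntegrable g volume a z :=
    hg.mono_set (uIcc_subset_uIcc_left hz)
  rw [hf x hx, hf y hy, dist_add_left, dist_eq_norm, Real.dist_eq, one_mul,
    intervalIntegral.integral_interval_sub_left (hint hx) (hint hy),
    intervalIntegral.integral_interval_sub_left (hint hx).norm (hint hy).norm]
  exact intervalIntegral.norm_integral_le_abs_integral_norm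

theorem ae_hasDerivAt_of_eq_add_integral [CompleteSpace E] (hg : IntervalIntegrable g volume a b)
    (hf : ∀ t ∈ uIcc a b, f t = c + ∫ s in a..t, g s) :
    ∀ᵐ t, t ∈ uIcc a b → HasDerivAt f (g t) t := by
  have hne (x : ℝ) : ∀ᵐ t : ℝ, t ≠ x := by simp [ae_iff]
  filter_upwards [hg.ae_hasDerivAt_integral, hne a, hne b] with t ht hta htb hmem
  have hnhds : uIcc a b ∈ 𝓝 t := by
    rw [mem_uIcc] at hmem
    rw [uIcc, Icc_mem_nhds_iff]
    grind
  exact ((ht hmem a left_mem_uIcc).const_add c).congr_of_eventuallyEq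
    (eventually_of_mem hnhds hf)

end AbsolutelyContinuous

section Propagator

variable {H : Type*} [NormedAddCommGroup H] [InnerProductSpace ℂ H] {T t : ℝ}
  {V W U K : ℝ → H →L[ℂ] H}

namespace IsPropagator

theorem apply_zero (hU : IsPropagator T V U) (hT : 0 ≤ T) : U 0 = 1 := by
  simpa using hU.schrodinger 0 ⟨le_rfl, hT⟩

variable [CompleteSpace H]

theorem eq_add_integral (hU : IsPropagator T V U) (ht : t ∈ Icc 0 T) :
    U t = 1 + ∫ s in (0 : ℝ)..t, -(Complex.I • (V s * U s)) := by
  rw [intervalIntegral.integral_neg, intervalIntegral.integral_smul, ← sub_eq_add_neg]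
  exact hU.schrodinger t ht

theorem intervalIntegrable (hU : IsPropagator T V U) (hV : IntervalIntegrable V volume 0 T)
    (hT : 0 ≤ T) : IntervalIntegrable (fun t => -(Complex.I • (V t * U t))) volume 0 T :=
  ((hV.mul_continuousOn (by rw [uIcc_of_le hT]; exact hU.continuousOn)).smul Complex.I).neg

theorem absolutelyContinuousOnInterval (hU : IsPropagator T V U)
    (hV : IntervalIntegrable V volume 0 T) (hT : 0 ≤ T) :
    AbsolutelyContinuousOnInterval U 0 T :=
  absolutelyContinuousOnInterval_of_eq_add_integral (hU.intervalIntegrable hV hT)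
    fun _ ht => hU.eq_add_integral (uIcc_of_le hT ▸ ht)

theorem ae_hasDerivAt (hU : IsPropagator T V U) (hV : IntervalIntegrable V volume 0 T)
    (hT : 0 ≤ T) :
    ∀ᵐ t, t ∈ uIcc 0 T → HasDerivAt U (-(Complex.I • (V t * U t))) t :=
  ae_hasDerivAt_of_eq_add_integral (hU.intervalIntegrable hV hT)
    fun _ ht => hU.eq_add_integral (uIcc_of_le hT ▸ ht)

theorem absolutelyContinuousOnInterval_star (hU : IsPropagator T V U)
    (hV : IntervalIntegrable V volume 0 T) (hT : 0 ≤ T) :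
    AbsolutelyContinuousOnInterval (fun t => star (U t)) 0 T :=
  absolutelyContinuousOnInterval_of_dist_le (C := 1) (hU.absolutelyContinuousOnInterval hV hT)
    fun x _ y _ => by rw [dist_eq_norm, ← star_sub, norm_star, ← dist_eq_norm, one_mul]

theorem ae_hasDerivAt_star (hU : IsPropagator T V U) (hV : IsHamiltonian T V) (hT : 0 ≤ T) :
    ∀ᵐ t, t ∈ uIcc 0 T → HasDerivAt (fun t => star (U t)) (Complex.I • (star (U t) * V t)) t := by
  filter_upwards [hU.ae_hasDerivAt hV.integrable hT] with t hd ht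
  have hVt := (hV.selfAdjoint t (uIcc_of_le hT ▸ ht)).star_eq
  simpa [hVt] using (hd ht).star

theorem star_mul_self (hU : IsPropagator T V U) (hV : IsHamiltonian T V) (ht : t ∈ Icc 0 T) :
    star (U t) * U t = 1 := by
  have hT : 0 ≤ T := ht.1.trans ht.2
  have hAC : AbsolutelyContinuousOnInterval (fun t => star (U t) * U t) 0 T :=
    absolutelyContinuousOnInterval_mul (hU.absolutelyContinuousOnInterval_star hV.integrable hT)
      (hU.absolutelyContinuousOnInterval hV.integrable hT)
  obtain ⟨c, hc⟩ := hAC.const_of_ae_hasDerivAt_zero (by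
      filter_upwards [hU.ae_hasDerivAt hV.integrable hT, hU.ae_hasDerivAt_star hV hT]
        with s hd hd' hs
      refine ((hd' hs).mul (hd hs)).congr_deriv ?_
      simp only [smul_mul_assoc, mul_neg, mul_smul_comm, mul_assoc, add_neg_cancel])
  rw [uIcc_of_le hT] at hc
  rw [hc t ht, ← hc 0 ⟨le_rfl, hT⟩, hU.apply_zero hT, star_one, mul_one]

theorem mem_unitary [FiniteDimensional ℂ H] (hU : IsPropagator T V U) (hV : IsHamiltonian T V)
    (ht : t ∈ Icc 0 T) : U t ∈ unitary (H →L[ℂ] H) := by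
  have : IsDedekindFiniteMonoid (H →L[ℂ] H) :=
    .of_injective ContinuousLinearMap.toLinearMapRingHom ContinuousLinearMap.coe_injective
  exact Unitary.mem_iff.2 ⟨hU.star_mul_self hV ht, mul_eq_one_comm.1 (hU.star_mul_self hV ht)⟩

theorem absolutelyContinuousOnInterval_state (hU : IsPropagator T V U)
    (hV : IntervalIntegrable V volume 0 T) (hT : 0 ≤ T) (ρ : H →L[ℂ] H) :
    AbsolutelyContinuousOnInterval (state U ρ) 0 T :=
  absolutelyContinuousOnInterval_mul
    (absolutelyContinuousOnInterval_mul (hU.absolutelyContinuousOnInterval hV hT)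
      (LipschitzWith.const ρ).lipschitzOnWith.absolutelyContinuousOnInterval)
    (hU.absolutelyContinuousOnInterval_star hV hT)

theorem ae_hasDerivAt_state (hU : IsPropagator T V U) (hV : IsHamiltonian T V) (hT : 0 ≤ T)
    (ρ : H →L[ℂ] H) :
    ∀ᵐ t, t ∈ uIcc 0 T →
      HasDerivAt (state U ρ) (-(Complex.I • (V t * state U ρ t - state U ρ t * V t))) t := by
  filter_upwards [hU.ae_hasDerivAt hV.integrable hT, hU.ae_hasDerivAt_star hV hT] with t hd hd' ht
  refine (((hd ht).mul_const ρ).mul (hd' ht)).congr_deriv ?_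
  simp only [state, neg_mul, smul_mul_assoc, mul_smul_comm, smul_sub, mul_assoc]
  abel

theorem star_mul_state_mul_eq (hU : IsPropagator T V U) (hK : IsPropagator T W K)
    (hV : IsHamiltonian T V) (hW : IsHamiltonian T W) {ρ : H →L[ℂ] H}
    (hcomm : ∀ t ∈ Icc 0 T, Commute (W t - V t) (state U ρ t)) (ht : t ∈ Icc 0 T) :
    star (K t) * state U ρ t * K t = ρ := by
  have hT : 0 ≤ T := ht.1.trans ht.2
  have hAC : AbsolutelyContinuousOnInterval (fun t => star (K t) * state U ρ t * K t) 0 T :=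
    absolutelyContinuousOnInterval_mul (absolutelyContinuousOnInterval_mul
      (hK.absolutelyContinuousOnInterval_star hW.integrable hT)
      (hU.absolutelyContinuousOnInterval_state hV.integrable hT ρ))
      (hK.absolutelyContinuousOnInterval hW.integrable hT)
  obtain ⟨c, hc⟩ := hAC.const_of_ae_hasDerivAt_zero (by
      filter_upwards [hU.ae_hasDerivAt_state hV hT ρ, hK.ae_hasDerivAt hW.integrable hT,
        hK.ae_hasDerivAt_star hW hT] with s hstate hd hd' hs
      refine (((hd' hs).mul (hstate hs)).mul (hd hs)).congr_deriv ?_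
      have hzero := sub_eq_zero.2 (hcomm s (uIcc_of_le hT ▸ hs)).eq
      calc _ = Complex.I • (star (K s) * ((W s - V s) * state U ρ s -
              state U ρ s * (W s - V s)) * K s) := by
            simp only [add_mul, mul_sub, sub_mul, smul_mul_assoc, mul_smul_comm, neg_mul,
              mul_neg, smul_sub, mul_assoc]
            abel
        _ = 0 := by rw [hzero, mul_zero, zero_mul, smul_zero])
  rw [uIcc_of_le hT] at hc
  rw [hc t ht, ← hc 0 ⟨le_rfl, hT⟩, hK.apply_zero hT, state, hU.apply_zero hT]
  simp only [star_one, one_mul, mul_one]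

theorem state_eq_of_commute [FiniteDimensional ℂ H] (hU : IsPropagator T V U)
    (hK : IsPropagator T W K) (hV : IsHamiltonian T V) (hW : IsHamiltonian T W) {ρ : H →L[ℂ] H}
    (hcomm : ∀ t ∈ Icc 0 T, Commute (W t - V t) (state U ρ t)) (ht : t ∈ Icc 0 T) :
    state K ρ t = state U ρ t := by
  have hKt := (Unitary.mem_iff.1 (hK.mem_unitary hW ht)).2
  have hρ := hU.star_mul_state_mul_eq hK hV hW hcomm ht
  calc state K ρ t = (K t * star (K t)) * state U ρ t * (K t * star (K t)) := by
        rw [state]; nth_rw 1 [← hρ]; noncomm_ring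
    _ = state U ρ t := by rw [hKt, one_mul, mul_one]

end IsPropagator
end Propagator

section LinearODE

variable {E : Type*} [NormedAddCommGroup E] [NormedSpace ℝ E] {T t : ℝ}

theorem integral_mul_exp_integral {g : ℝ → ℝ} (hg : IntervalIntegrable g volume 0 T) :
    ∫ t in (0 : ℝ)..T, g t * Real.exp (2 * ∫ s in (0 : ℝ)..t, g s) =
      (Real.exp (2 * ∫ s in (0 : ℝ)..T, g s) - 1) / 2 := by
  have hAC : AbsolutelyContinuousOnInterval
      (fun t => Real.exp (2 * ∫ s in (0 : ℝ)..t, g s)) 0 T :=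
    absolutelyContinuousOnInterval_contDiffAt_comp (φ := fun x => Real.exp (2 * x))
      (fun _ _ => by fun_prop)
      (hg.absolutelyContinuousOnInterval_intervalIntegral left_mem_uIcc)
  have hFTC := hAC.integral_deriv_eq_sub
  rw [intervalIntegral.integral_same, mul_zero, Real.exp_zero] at hFTC
  rw [← hFTC, ← intervalIntegral.integral_div]
  refine intervalIntegral.integral_congr_ae ?_
  filter_upwards [hg.ae_hasDerivAt_integral] with t ht hmem
  rw [(((ht (uIoc_subset_uIcc hmem) 0 left_mem_uIcc).const_mul 2).exp).deriv]
  ring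

variable {A : Type*} [NormedRing A] [Module A E] [IsBoundedSMul A E] {a : ℝ → A} {w : ℝ → ℝ}
  {v v' : ℝ → E}

/-- The Picard map of the linear equation `u' = a • u`, `u 0 = u₀`, conjugated by the weight `w`:
its fixed points are the functions `w⁻¹ • u` for solutions `u`. A weight that grows fast enough
turns it into a contraction on the whole interval. -/
def weightedPicard (a : ℝ → A) (w : ℝ → ℝ) (u₀ : E) (v : ℝ → E) (t : ℝ) : E :=
  (w t)⁻¹ • (u₀ + ∫ s in (0 : ℝ)..t, a s • w s • v s)

theorem continuousOn_weightedPicard (ha : IntervalIntegrable a volume 0 T) (hT : 0 ≤ T)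
    (hw : ContinuousOn w (Icc 0 T)) (hw0 : ∀ t, 0 < w t) (u₀ : E)
    (hv : ContinuousOn v (Icc 0 T)) : ContinuousOn (weightedPicard a w u₀ v) (Icc 0 T) := by
  rw [← uIcc_of_le hT] at hw hv ⊢
  exact (hw.inv₀ fun t _ => (hw0 t).ne').smul <| continuousOn_const.add <|
    intervalIntegral.continuousOn_primitive_interval' (ha.smul_continuousOn (hw.smul hv))
      left_mem_uIcc

theorem dist_weightedPicard_le (ha : IntervalIntegrable a volume 0 T)
    (hw : ContinuousOn w (Icc 0 T)) (hw0 : ∀ t, 0 < w t) (u₀ : E)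
    (hv : ContinuousOn v (Icc 0 T)) (hv' : ContinuousOn v' (Icc 0 T)) (ht : t ∈ Icc 0 T)
    {q C : ℝ} (hq : ∫ s in (0 : ℝ)..t, ‖a s‖ * w s ≤ q * w t) (hC0 : 0 ≤ C)
    (hC : ∀ s ∈ Icc 0 T, dist (v s) (v' s) ≤ C) :
    dist (weightedPicard a w u₀ v t) (weightedPicard a w u₀ v' t) ≤ q * C := by
  have hsub : uIcc 0 t ⊆ Icc 0 T := uIcc_of_le ht.1 ▸ Icc_subset_Icc_right ht.2
  have hat : IntervalIntegrable a volume 0 t :=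
    ha.mono_set (hsub.trans (uIcc_of_le (ht.1.trans ht.2)).ge)
  have hint {z : ℝ → E} (hz : ContinuousOn z (Icc 0 T)) :
      IntervalIntegrable (fun s => a s • w s • z s) volume 0 t :=
    hat.smul_continuousOn ((hw.smul hz).mono hsub)
  have hpoint (s : ℝ) (hs : s ∈ Ioc 0 t) :
      ‖a s • w s • v s - a s • w s • v' s‖ ≤ ‖a s‖ * w s * C := by
    rw [← dist_eq_norm, mul_assoc]
    refine (dist_smul_le _ _ _).trans ?_
    rw [dist_smul₀, Real.norm_of_nonneg (hw0 s).le]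
    gcongr
    · exact (hw0 s).le
    · exact hC s ⟨hs.1.le, hs.2.trans ht.2⟩
  rw [weightedPicard, weightedPicard, dist_smul₀, dist_add_left, dist_eq_norm, norm_inv,
    Real.norm_of_nonneg (hw0 t).le, inv_mul_le_iff₀ (hw0 t),
    ← intervalIntegral.integral_sub (hint hv) (hint hv')]
  calc ‖∫ s in (0 : ℝ)..t, (a s • w s • v s - a s • w s • v' s)‖
      ≤ ∫ s in (0 : ℝ)..t, ‖a s‖ * w s * C :=
        intervalIntegral.norm_integral_le_of_norm_le ht.1 (.of_forall hpoint)
          ((hat.norm.mul_continuousOn (hw.mono hsub)).mul_const C)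
    _ = (∫ s in (0 : ℝ)..t, ‖a s‖ * w s) * C := intervalIntegral.integral_mul_const _ _
    _ ≤ q * w t * C := by gcongr
    _ = w t * (q * C) := by ring

theorem exists_eq_add_integral_smul [CompleteSpace E] (ha : IntervalIntegrable a volume 0 T)
    (hT : 0 ≤ T) (u₀ : E) :
    ∃ u : ℝ → E, ContinuousOn u (Icc 0 T) ∧
      ∀ t ∈ Icc 0 T, u t = u₀ + ∫ s in (0 : ℝ)..t, a s • u s := by
  set w : ℝ → ℝ := fun s => Real.exp (2 * ∫ r in (0 : ℝ)..s, ‖a r‖)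
  have hw0 (t : ℝ) : 0 < w t := Real.exp_pos _
  have hw : ContinuousOn w (Icc 0 T) := uIcc_of_le hT ▸
    ((intervalIntegral.continuousOn_primitive_interval' ha.norm left_mem_uIcc).const_mul 2).rexp
  have hq (t : ℝ) (ht : t ∈ Icc 0 T) : ∫ s in (0 : ℝ)..t, ‖a s‖ * w s ≤ 1 / 2 * w t := by
    rw [integral_mul_exp_integral (ha.norm.mono_set (uIcc_subset_uIcc_left (uIcc_of_le hT ▸ ht)))]
    linarith
  have hcont (v : C(Icc 0 T, E)) : ContinuousOn (IccExtend hT v) (Icc 0 T) :=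
    v.continuous.Icc_extend'.continuousOn
  let Φ (v : C(Icc 0 T, E)) : C(Icc 0 T, E) :=
    ⟨(Icc 0 T).domRestrict (weightedPicard a w u₀ (IccExtend hT v)),
      (continuousOn_weightedPicard ha hT hw hw0 u₀ (hcont v)).domRestrict⟩
  have hΦ : ContractingWith (1 / 2) Φ := by
    refine ⟨by rw [← NNReal.coe_lt_coe]; norm_num, LipschitzWith.of_dist_le_mul fun v v' => ?_⟩
    refine (ContinuousMap.dist_le (by positivity)).2 fun t => ?_
    refine dist_weightedPicard_le ha hw hw0 u₀ (hcont v) (hcont v') t.2 (by simpa using hq t t.2)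
      dist_nonneg fun s hs => ?_
    rw [IccExtend_of_mem hT v hs, IccExtend_of_mem hT v' hs]
    exact ContinuousMap.dist_apply_le_dist _
  have : Nonempty C(Icc 0 T, E) := ⟨0⟩
  obtain ⟨v, hv⟩ : ∃ v, Φ v = v := ⟨_, hΦ.fixedPoint_isFixedPt⟩
  refine ⟨fun t => w t • IccExtend hT v t, hw.smul (hcont v), fun t ht => ?_⟩
  have hvt : IccExtend hT v t = weightedPicard a w u₀ (IccExtend hT v) t := by
    rw [IccExtend_of_mem hT v ht]
    exact (DFunLike.congr_fun hv ⟨t, ht⟩).symm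
  dsimp only
  rw [hvt, weightedPicard, smul_inv_smul₀ (hw0 t).ne']

end LinearODE

section Existence

variable {H : Type*} [NormedAddCommGroup H] [InnerProductSpace ℂ H] [CompleteSpace H] {T : ℝ}
  {V : ℝ → H →L[ℂ] H}

theorem exists_isPropagator (hV : IntervalIntegrable V volume 0 T) (hT : 0 ≤ T) :
    ∃ U, IsPropagator T V U := by
  obtain ⟨U, hU, h⟩ := exists_eq_add_integral_smul (hV.smul Complex.I).neg hT (1 : H →L[ℂ] H)
  refine ⟨U, hU, fun t ht => ?_⟩
  rw [h t ht, sub_eq_add_neg, ← intervalIntegral.integral_smul, ← intervalIntegral.integral_neg]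
  simp

end Existence

section ArcLength

variable {a b : ℝ} {g : ℝ → ℝ}

theorem abs_deriv_arccos_mul_le {c x x' y : ℝ} (hc : c ∈ Ioo 0 1) (hx : x ∈ Icc (-1) 1)
    (hy : 0 ≤ y) (hx' : |x'| ≤ y * √(1 - x ^ 2)) : |-(1 / √(1 - (c * x) ^ 2)) * (c * x')| ≤ y := by
  have hx2 : x ^ 2 ≤ 1 := by nlinarith [hx.1, hx.2]
  have hc2 : c ^ 2 < 1 := by nlinarith [hc.1, hc.2]
  have hpos : 0 < 1 - (c * x) ^ 2 := by nlinarith [sq_nonneg c]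
  have hle : c * √(1 - x ^ 2) ≤ √(1 - (c * x) ^ 2) := by
    rw [← Real.sqrt_sq hc.1.le, ← Real.sqrt_mul (sq_nonneg c), Real.sqrt_sq hc.1.le]
    exact Real.sqrt_le_sqrt (by linarith [mul_pow c x 2])
  rw [neg_mul, abs_neg, abs_mul, abs_mul, abs_of_pos hc.1, abs_of_pos (by positivity), one_div,
    inv_mul_le_iff₀ (by positivity)]
  calc c * |x'| ≤ c * (y * √(1 - x ^ 2)) := by gcongr; exact hc.1.le
    _ = y * (c * √(1 - x ^ 2)) := by ring
    _ ≤ y * √(1 - (c * x) ^ 2) := by gcongr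
    _ = _ := mul_comm _ _

theorem arccos_sub_arccos_le_integral (hab : a ≤ b) {f f' : ℝ → ℝ}
    (hf : AbsolutelyContinuousOnInterval f a b) (hf1 : ∀ t ∈ Icc a b, f t ∈ Icc (-1) 1)
    (hg : IntervalIntegrable g volume a b)
    (hf' : ∀ᵐ t, t ∈ uIcc a b →
      HasDerivAt f (f' t) t ∧ 0 ≤ g t ∧ |f' t| ≤ g t * √(1 - f t ^ 2)) :
    Real.arccos (f b) - Real.arccos (f a) ≤ ∫ t in a..b, g t := by
  -- `arccos` is not differentiable at `±1`, so `f` is first scaled into the open interval.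
  have hscaled (c : ℝ) (hc : c ∈ Ioo 0 1) :
      Real.arccos (c * f b) - Real.arccos (c * f a) ≤ ∫ t in a..b, g t := by
    have hmem (t : ℝ) (ht : t ∈ uIcc a b) : c * f t ∈ Ioo (-1) 1 := by
      obtain ⟨h1, h2⟩ := hf1 t (uIcc_of_le hab ▸ ht)
      constructor <;> nlinarith [hc.1, hc.2]
    have hAC : AbsolutelyContinuousOnInterval (fun t => Real.arccos (c * f t)) a b :=
      absolutelyContinuousOnInterval_contDiffAt_comp (φ := fun x => Real.arccos (c * x))
        (fun t ht => (Real.contDiffAt_arccos (hmem t ht).1.ne' (hmem t ht).2.ne).comp _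
          (by fun_prop)) hf
    rw [← hAC.integral_deriv_eq_sub]
    refine intervalIntegral.integral_mono_ae_restrict hab hAC.intervalIntegrable_deriv hg ?_
    rw [EventuallyLE, ae_restrict_iff' measurableSet_Icc]
    filter_upwards [hf'] with t ht hmem_t
    obtain ⟨hderiv, hg0, hle⟩ := ht (uIcc_of_le hab ▸ hmem_t)
    obtain ⟨hlt, hlt'⟩ := hmem t (uIcc_of_le hab ▸ hmem_t)
    refine ((Real.hasDerivAt_arccos hlt.ne' hlt'.ne).comp t (hderiv.const_mul c)).deriv.trans_le ?_
    exact (le_abs_self _).trans (abs_deriv_arccos_mul_le hc (hf1 t hmem_t) hg0 hle)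
  have hlim : Tendsto (fun c : ℝ => Real.arccos (c * f b) - Real.arccos (c * f a)) (𝓝[<] 1)
      (𝓝 (Real.arccos (f b) - Real.arccos (f a))) := by
    have hcont : Continuous fun c : ℝ => Real.arccos (c * f b) - Real.arccos (c * f a) := by
      fun_prop
    simpa using (hcont.tendsto 1).mono_left nhdsWithin_le_nhds
  exact le_of_tendsto hlim (eventually_of_mem (Ioo_mem_nhdsLT one_pos) hscaled)

variable {E : Type*} [NormedAddCommGroup E] [InnerProductSpace ℝ E]

open RealInnerProductSpace

theorem abs_inner_le_mul_sqrt {x y z : E} (hx : ‖x‖ = 1) (hy : ‖y‖ = 1) (hyz : ⟪y, z⟫ = 0) :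
    |⟪x, z⟫| ≤ ‖z‖ * √(1 - ⟪x, y⟫ ^ 2) := by
  have hproj : ‖x - ⟪x, y⟫ • y‖ ^ 2 = 1 - ⟪x, y⟫ ^ 2 := by
    rw [norm_sub_sq_real, norm_smul, inner_smul_right, hx, hy, Real.norm_eq_abs, mul_one, sq_abs]
    ring
  calc |⟪x, z⟫| = |⟪x - ⟪x, y⟫ • y, z⟫| := by
        rw [inner_sub_left, real_inner_smul_left, hyz, mul_zero, sub_zero]
    _ ≤ ‖x - ⟪x, y⟫ • y‖ * ‖z‖ := abs_real_inner_le_norm _ _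
    _ = ‖z‖ * √(1 - ⟪x, y⟫ ^ 2) := by rw [← hproj, Real.sqrt_sq (norm_nonneg _), mul_comm]

theorem inner_eq_zero_of_norm_eqOn {s : Set ℝ} {γ : ℝ → E} {v : E} {t r : ℝ}
    (hγ : ∀ t ∈ s, ‖γ t‖ = r) (hs : UniqueDiffOn ℝ s) (ht : t ∈ s)
    (hv : HasDerivWithinAt γ v s t) : ⟪γ t, v⟫ = 0 := by
  have hconst : HasDerivWithinAt (fun t => ‖γ t‖ ^ 2) 0 s t :=
    (hasDerivWithinAt_const t s (r ^ 2)).congr (fun y hy => by rw [hγ y hy]) (by rw [hγ t ht])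
  simpa using (hs t ht).eq_deriv _ hv.norm_sq hconst

theorem angle_le_integral (hab : a ≤ b) {γ γ' : ℝ → E}
    (hγ : AbsolutelyContinuousOnInterval γ a b) (hγ1 : ∀ t ∈ Icc a b, ‖γ t‖ = 1)
    (hg : IntervalIntegrable g volume a b)
    (hγ' : ∀ᵐ t, t ∈ uIcc a b → HasDerivAt γ (γ' t) t ∧ ‖γ' t‖ ≤ g t) :
    InnerProductGeometry.angle (γ a) (γ b) ≤ ∫ t in a..b, g t := by
  obtain rfl | hlt := hab.eq_or_lt
  · rw [intervalIntegral.integral_same,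
      InnerProductGeometry.angle_self (norm_ne_zero_iff.1 (by simp [hγ1 a ⟨le_rfl, le_rfl⟩]))]
  have ha := hγ1 a ⟨le_rfl, hab⟩
  have hf : AbsolutelyContinuousOnInterval (fun t => ⟪γ a, γ t⟫) a b :=
    absolutelyContinuousOnInterval_contDiffAt_comp (φ := fun x => ⟪γ a, x⟫)
      (fun _ _ => (innerSL ℝ (γ a)).contDiff.contDiffAt) hγ
  have h := arccos_sub_arccos_le_integral hab hf (fun t ht => ?_) hg (f' := fun t => ⟪γ a, γ' t⟫) ?_
  · simpa [InnerProductGeometry.angle, ha, hγ1 b ⟨hab, le_rfl⟩] using h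
  · simpa [ha, hγ1 t ht, abs_le] using abs_real_inner_le_norm (γ a) (γ t)
  · filter_upwards [hγ'] with t ht hmem
    obtain ⟨hd, hle⟩ := ht hmem
    rw [uIcc_of_le hab] at hmem
    refine ⟨(innerSL ℝ (γ a)).hasFDerivAt.comp_hasDerivAt t hd, (norm_nonneg _).trans hle, ?_⟩
    have horth := inner_eq_zero_of_norm_eqOn hγ1 (uniqueDiffOn_Icc hlt) hmem hd.hasDerivWithinAt
    exact (abs_inner_le_mul_sqrt ha (hγ1 t hmem) horth).trans (by gcongr)

end ArcLength

section Logarithm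

theorem expUnitary_argSelfAdjoint_of_finite_spectrum {A : Type*} [CStarAlgebra A] {u : unitary A}
    (hu : (spectrum ℂ (u : A)).Finite) :
    selfAdjoint.expUnitary (Unitary.argSelfAdjoint u) = u := by
  have hcont (f : ℂ → ℂ) : ContinuousOn f (spectrum ℂ (u : A)) := hu.continuousOn f
  ext
  rw [selfAdjoint.expUnitary_coe, Unitary.argSelfAdjoint_coe,
    ← CFC.exp_eq_normedSpace_exp (𝕜 := ℂ), ← cfc_smul Complex.I _ (u : A) (hcont _),
    ← cfc_comp' _ _ (u : A) (by fun_prop) (hcont _)]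
  conv_rhs => rw [← cfc_id' ℂ (u : A)]
  refine cfc_congr fun z hz => ?_
  have hpolar := Complex.norm_mul_exp_arg_mul_I z
  rw [spectrum.norm_eq_one_of_unitary u.2 hz, Complex.ofReal_one, one_mul] at hpolar
  rw [← Complex.exp_eq_exp_ℂ, smul_eq_mul, mul_comm, hpolar]

theorem norm_argSelfAdjoint_le {A : Type*} [CStarAlgebra A] {u : unitary A} {L : ℝ} (hL : 0 ≤ L)
    (hu : ∀ z ∈ spectrum ℂ (u : A), |z.arg| ≤ L) : ‖Unitary.argSelfAdjoint u‖ ≤ L :=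
  norm_cfc_le hL fun z hz => by simpa using hu z hz

theorem exists_isSelfAdjoint_exp_eq_of_abs_arg_le {A : Type*} [CStarAlgebra A] {u : A}
    (hu : u ∈ unitary A) (hfin : (spectrum ℂ u).Finite) {L : ℝ} (hL : 0 ≤ L)
    (harg : ∀ z ∈ spectrum ℂ u, |z.arg| ≤ L) :
    ∃ a : A, IsSelfAdjoint a ∧ NormedSpace.exp (-(Complex.I • a)) = u ∧ ‖a‖ ≤ L := by
  have hexp := congrArg Subtype.val
    (expUnitary_argSelfAdjoint_of_finite_spectrum (u := ⟨u, hu⟩) hfin)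
  rw [selfAdjoint.expUnitary_coe] at hexp
  refine ⟨_, (Unitary.argSelfAdjoint ⟨u, hu⟩).2.neg, ?_, ?_⟩
  · rwa [smul_neg, neg_neg]
  · rw [norm_neg]
    exact norm_argSelfAdjoint_le (u := ⟨u, hu⟩) hL harg

theorem exists_norm_eq_one_apply_eq_smul {𝕜 E : Type*} [RCLike 𝕜] [NormedAddCommGroup E]
    [NormedSpace 𝕜 E] [FiniteDimensional 𝕜 E] {W : E →L[𝕜] E} {z : 𝕜} (hz : z ∈ spectrum 𝕜 W) :
    ∃ x : E, ‖x‖ = 1 ∧ W x = z • x := by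
  have := FiniteDimensional.complete 𝕜 E
  rw [ContinuousLinearMap.spectrum_eq, ← Module.End.hasEigenvalue_iff_mem_spectrum] at hz
  obtain ⟨v, hv⟩ := hz.exists_hasEigenvector
  refine ⟨(‖v‖⁻¹ : 𝕜) • v, norm_smul_inv_norm hv.2, ?_⟩
  rw [map_smul, smul_comm]
  exact congrArg _ hv.apply_eq_smul

variable {H : Type*} [NormedAddCommGroup H] [InnerProductSpace ℂ H]

theorem arccos_re_inner_smul_eq_abs_arg {x : H} (hx : ‖x‖ = 1) {z : ℂ} (hz : ‖z‖ = 1) :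
    Real.arccos (inner ℂ x (z • x)).re = |z.arg| := by
  rw [← Complex.angle_one_left (norm_ne_zero_iff.1 (by simp [hz])), InnerProductGeometry.angle,
    inner_smul_right, inner_self_eq_norm_sq_to_K, hx]
  simp [hz]

variable [CompleteSpace H] {T : ℝ} {V U : ℝ → H →L[ℂ] H}

theorem IsPropagator.arccos_re_inner_le_integral_norm (hU : IsPropagator T V U)
    (hV : IsHamiltonian T V) (hT : 0 ≤ T) {x : H} (hx : ‖x‖ = 1) :
    Real.arccos (inner ℂ x (U T x)).re ≤ ∫ t in (0 : ℝ)..T, ‖V t‖ := by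
  let := InnerProductSpace.complexToReal (G := H)
  have hnorm (t : ℝ) (ht : t ∈ Icc 0 T) : ‖U t x‖ = 1 := by
    rw [(U t).norm_map_iff_adjoint_comp_self.2 (hU.star_mul_self hV ht), hx]
  let eval : (H →L[ℂ] H) →L[ℝ] H := (ContinuousLinearMap.apply ℂ H x).restrictScalars ℝ
  have hAC : AbsolutelyContinuousOnInterval (fun t => U t x) 0 T :=
    absolutelyContinuousOnInterval_contDiffAt_comp (φ := eval)
      (fun _ _ => eval.contDiff.contDiffAt) (hU.absolutelyContinuousOnInterval hV.integrable hT)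
  have h := angle_le_integral (γ' := fun t => -(Complex.I • V t (U t x))) hT hAC hnorm
    hV.integrable.norm ?_
  · rw [InnerProductGeometry.angle, hU.apply_zero hT, hnorm T ⟨hT, le_rfl⟩,
      real_inner_eq_re_inner ℂ] at h
    simpa [hx] using h
  · filter_upwards [hU.ae_hasDerivAt hV.integrable hT] with t hd ht
    refine ⟨eval.hasFDerivAt.comp_hasDerivAt t (hd ht), ?_⟩
    rw [norm_neg, norm_smul, Complex.norm_I, one_mul]
    simpa [hnorm t (uIcc_of_le hT ▸ ht)] using (V t).le_opNorm (U t x)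

variable [FiniteDimensional ℂ H]

theorem IsPropagator.abs_arg_le_integral_norm (hU : IsPropagator T V U) (hV : IsHamiltonian T V)
    (hT : 0 ≤ T) {z : ℂ} (hz : z ∈ spectrum ℂ (U T)) : |z.arg| ≤ ∫ t in (0 : ℝ)..T, ‖V t‖ := by
  obtain ⟨x, hx, hUx⟩ := exists_norm_eq_one_apply_eq_smul hz
  have hz1 := spectrum.norm_eq_one_of_unitary (hU.mem_unitary hV ⟨hT, le_rfl⟩) hz
  rw [← arccos_re_inner_smul_eq_abs_arg hx hz1, ← hUx]
  exact hU.arccos_re_inner_le_integral_norm hV hT hx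

end Logarithm

section Generators

variable {H : Type*} [NormedAddCommGroup H] [InnerProductSpace ℂ H] [CompleteSpace H]
  {ρ σ A : H →L[ℂ] H} {T : ℝ} {V W U : ℝ → H →L[ℂ] H}

/-- The self-adjoint `A` whose constant Hamiltonian drives `ρ` to `σ` in unit time. -/
def generators (ρ σ : H →L[ℂ] H) : Set (H →L[ℂ] H) :=
  {A | IsSelfAdjoint A ∧ NormedSpace.exp (-(Complex.I • A)) * ρ *
    star (NormedSpace.exp (-(Complex.I • A))) = σ}

theorem eq_of_zero_mem_generators (h : 0 ∈ generators ρ σ) : ρ = σ := by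
  simpa using h.2

theorem isClosed_generators (ρ σ : H →L[ℂ] H) : IsClosed (generators ρ σ) := by
  let := NormedAlgebra.restrictScalars ℚ ℂ (H →L[ℂ] H)
  have : Continuous (NormedSpace.exp : (H →L[ℂ] H) → H →L[ℂ] H) :=
    NormedSpace.exp_continuous
  exact (isClosed_eq continuous_star continuous_id).inter
    (isClosed_eq (by fun_prop) continuous_const)

theorem isHamiltonian_const (hA : IsSelfAdjoint A) (T : ℝ) : IsHamiltonian T fun _ => A :=
  ⟨fun _ _ => hA, intervalIntegrable_const⟩

theorem isPropagator_const (T : ℝ) (A : H →L[ℂ] H) :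
    IsPropagator T (fun _ => A) fun t => NormedSpace.exp (t • -(Complex.I • A)) := by
  have hderiv (t : ℝ) := hasDerivAt_exp_smul_const' (𝕂 := ℝ) (-(Complex.I • A)) t
  have hcont : Continuous fun t : ℝ => NormedSpace.exp (t • -(Complex.I • A)) :=
    continuous_iff_continuousAt.2 fun t => (hderiv t).continuousAt
  refine ⟨hcont.continuousOn, fun t _ => ?_⟩
  have h := intervalIntegral.integral_eq_sub_of_hasDerivAt (a := 0) (b := t)
    (fun s _ => hderiv s) ((continuous_const.mul hcont).intervalIntegrable _ _)
  simp only [zero_smul, NormedSpace.exp_zero, neg_mul, smul_mul_assoc,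
    intervalIntegral.integral_neg, intervalIntegral.integral_smul] at h
  rw [sub_eq_add_neg, h, add_sub_cancel]

theorem state_exp_of_mem_generators (hA : A ∈ generators ρ σ) (hT : T ≠ 0) :
    state (fun t => NormedSpace.exp (t • -(Complex.I • (T⁻¹ • A)))) ρ T = σ := by
  rw [state, smul_neg, smul_comm, smul_inv_smul₀ hT]
  exact hA.2

theorem norm_mem_chargingTimes [Nontrivial H] (hA : A ∈ generators ρ σ) :
    ‖A‖ ∈ chargingTimes ρ σ := by
  refine ⟨norm_nonneg A, ?_⟩
  obtain rfl | hA0 := eq_or_ne A 0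
  · refine ⟨_, _, isHamiltonian_const (.one _) _, fun _ _ => norm_one, isPropagator_const _ 1, ?_⟩
    simpa [state] using eq_of_zero_mem_generators hA
  · have hn : ‖A‖ ≠ 0 := norm_ne_zero_iff.2 hA0
    refine ⟨_, _, isHamiltonian_const ((IsSelfAdjoint.all ‖A‖⁻¹).smul hA.1) _, fun _ _ => ?_,
      isPropagator_const _ _, state_exp_of_mem_generators hA hn⟩
    rw [norm_smul, norm_inv, norm_norm, inv_mul_cancel₀ hn]

theorem exists_evolution_integral_norm_eq (hA : A ∈ generators ρ σ) (hT : 0 < T) :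
    ∃ V U, IsHamiltonian T V ∧ IsPropagator T V U ∧ state U ρ T = σ ∧
      ∫ t in (0 : ℝ)..T, ‖V t‖ = ‖A‖ := by
  refine ⟨_, _, isHamiltonian_const ((IsSelfAdjoint.all T⁻¹).smul hA.1) T,
    isPropagator_const _ _, state_exp_of_mem_generators hA hT.ne', ?_⟩
  rw [intervalIntegral.integral_const, sub_zero, norm_smul, norm_inv, Real.norm_of_nonneg hT.le,
    smul_eq_mul, mul_inv_cancel_left₀ hT.ne']

variable [FiniteDimensional ℂ H]

theorem IsPropagator.exists_mem_generators (hU : IsPropagator T V U) (hV : IsHamiltonian T V)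
    (hT : 0 ≤ T) (ρ : H →L[ℂ] H) :
    ∃ A ∈ generators ρ (state U ρ T), ‖A‖ ≤ ∫ t in (0 : ℝ)..T, ‖V t‖ := by
  have hfin : (spectrum ℂ (U T)).Finite := by
    rw [ContinuousLinearMap.spectrum_eq]
    exact Module.End.finite_spectrum _
  obtain ⟨A, hA, hexp, hAV⟩ := exists_isSelfAdjoint_exp_eq_of_abs_arg_le
    (hU.mem_unitary hV ⟨hT, le_rfl⟩) hfin
    (intervalIntegral.integral_nonneg hT fun _ _ => norm_nonneg _)
    fun z hz => hU.abs_arg_le_integral_norm hV hT hz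
  exact ⟨A, ⟨hA, by rw [hexp, state]⟩, hAV⟩

theorem IsPropagator.exists_mem_generators_of_mem_modifiedCosts (hU : IsPropagator T V U)
    (hV : IsHamiltonian T V) (hT : 0 ≤ T) {c : ℝ} (hc : c ∈ modifiedCosts T V (state U ρ)) :
    ∃ A ∈ generators ρ (state U ρ T), ‖A‖ ≤ c := by
  obtain ⟨D, hD, hcomm, rfl⟩ := hc
  have hW : IsHamiltonian T fun t => V t + D t :=
    ⟨fun t ht => (hV.selfAdjoint t ht).add (hD.selfAdjoint t ht), hV.integrable.add hD.integrable⟩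
  obtain ⟨K, hK⟩ := exists_isPropagator hW.integrable hT
  rw [← hU.state_eq_of_commute hK hV hW (fun t ht => by simpa using hcomm t ht) ⟨hT, le_rfl⟩]
  exact hK.exists_mem_generators hW hT ρ

theorem isLeast_chargingTimes_norm [Nontrivial H] (hA : A ∈ generators ρ σ)
    (hmin : ∀ B ∈ generators ρ σ, ‖A‖ ≤ ‖B‖) : IsLeast (chargingTimes ρ σ) ‖A‖ := by
  refine ⟨norm_mem_chargingTimes hA, ?_⟩
  rintro T ⟨hT, V, U, hV, hV1, hU, rfl⟩
  obtain ⟨B, hB, hBV⟩ := hU.exists_mem_generators hV hT ρ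
  calc ‖A‖ ≤ ‖B‖ := hmin B hB
    _ ≤ ∫ t in (0 : ℝ)..T, ‖V t‖ := hBV
    _ = ∫ _ in (0 : ℝ)..T, (1 : ℝ) :=
      intervalIntegral.integral_congr fun t ht => hV1 t (uIcc_of_le hT ▸ ht)
    _ = T := by rw [intervalIntegral.integral_const, sub_zero, smul_eq_mul, mul_one]

theorem exists_mem_generators_isLeast_norm [Nontrivial H] (h : (generators ρ σ).Nonempty) :
    ∃ A ∈ generators ρ σ, IsLeast (chargingTimes ρ σ) ‖A‖ ∧ ∀ B ∈ generators ρ σ, ‖A‖ ≤ ‖B‖ := by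
  have : ProperSpace (H →L[ℂ] H) := FiniteDimensional.proper ℂ _
  obtain ⟨A, hA, hdist⟩ := (isClosed_generators ρ σ).exists_infDist_eq_dist h 0
  have hmin (B) (hB : B ∈ generators ρ σ) : ‖A‖ ≤ ‖B‖ := by
    simpa [hdist] using Metric.infDist_le_dist_of_mem (x := 0) hB
  exact ⟨A, hA, isLeast_chargingTimes_norm hA hmin, hmin⟩

end Generators

section Selection

theorem infEDist_le_iff_exists_edist_le {X : Type*} [PseudoMetricSpace X] [ProperSpace X]
    {s : Set X} (hs : IsClosed s) (x : X) {r : ENNReal} (hr : r ≠ ⊤) :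
    Metric.infEDist x s ≤ r ↔ ∃ y ∈ s, edist x y ≤ r := by
  refine ⟨fun h => ?_, fun ⟨y, hy, hyr⟩ => (Metric.infEDist_le_edist_of_mem hy).trans hyr⟩
  have hne : s.Nonempty := nonempty_iff_ne_empty.2 (by rintro rfl; simp_all)
  obtain ⟨y, hy, hdist⟩ := hs.exists_infDist_eq_dist hne x
  refine ⟨y, hy, ?_⟩
  rwa [edist_dist, ← hdist, Metric.infDist, ENNReal.ofReal_toReal (Metric.infEDist_ne_top hne)]

variable {α : Type*} [TopologicalSpace α]

theorem lowerSemicontinuous_infEDist_section {X : Type*} [PseudoMetricSpace X] [ProperSpace X]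
    {G : Set (α × X)} (hG : IsClosed G) (x₀ : X) :
    LowerSemicontinuous fun v => Metric.infEDist x₀ {x | (v, x) ∈ G} := by
  refine lowerSemicontinuous_iff_isClosed_preimage.2 fun r => ?_
  obtain rfl | hr := eq_or_ne r ⊤
  · simp
  have : CompactSpace (Metric.closedBall x₀ r.toReal) :=
    isCompact_iff_compactSpace.1 (isCompact_closedBall _ _)
  convert isClosedMap_fst_of_compactSpace
    {p : α × Metric.closedBall x₀ r.toReal | (p.1, (p.2 : X)) ∈ G} (hG.preimage (by fun_prop))
  ext v
  have hGv : IsClosed {x | (v, x) ∈ G} := hG.preimage (by fun_prop)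
  simp [infEDist_le_iff_exists_edist_le hGv x₀ hr, edist_dist, dist_comm,
    ENNReal.ofReal_le_iff_le_toReal hr, and_comm]

variable [MeasurableSpace α] [OpensMeasurableSpace α]

theorem measurable_of_unique_nearest {X : Type*} [PseudoMetricSpace X] [ProperSpace X]
    [MeasurableSpace X] [BorelSpace X] {G : Set (α × X)} (hG : IsClosed G) {f : α → X}
    (hf : ∀ v, (v, f v) ∈ G) {x₀ : X}
    (hmin : ∀ v x, (v, x) ∈ G → edist x₀ x ≤ edist x₀ (f v) → x = f v) : Measurable f := by
  refine measurable_of_isClosed fun B hB => ?_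
  have hGB : IsClosed (G ∩ Prod.snd ⁻¹' B) := hG.inter (hB.preimage continuous_snd)
  have hiff (v : α) : f v ∈ B ↔ Metric.infEDist x₀ {x | (v, x) ∈ G ∩ Prod.snd ⁻¹' B} ≤
      Metric.infEDist x₀ {x | (v, x) ∈ G} := by
    constructor
    · intro hv
      have hmem : f v ∈ {x | (v, x) ∈ G ∩ Prod.snd ⁻¹' B} := ⟨hf v, hv⟩
      refine (Metric.infEDist_le_edist_of_mem hmem).trans (Metric.le_infEDist.2 fun x hx => ?_)
      obtain hle | hlt := le_or_gt (edist x₀ (f v)) (edist x₀ x)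
      · exact hle
      · rw [hmin v x hx hlt.le]
    · intro hv
      obtain ⟨x, ⟨hxG, hxB⟩, hx⟩ := (infEDist_le_iff_exists_edist_le
        (hGB.preimage (by fun_prop : Continuous fun x => (v, x))) x₀ (edist_ne_top x₀ (f v))).1
        (hv.trans (Metric.infEDist_le_edist_of_mem (hf v)))
      exact hmin v x hxG hx ▸ hxB
  convert measurableSet_le (lowerSemicontinuous_infEDist_section hGB x₀).measurable
    (lowerSemicontinuous_infEDist_section hG x₀).measurable
  exact Set.ext hiff

theorem exists_unique_nearest_of_convex {F : Type*} [NormedAddCommGroup F] [NormedSpace ℝ F]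
    [StrictConvexSpace ℝ F] [ProperSpace F] {s : Set F} (hs : IsClosed s) (hne : s.Nonempty)
    (hconv : Convex ℝ s) : ∃ x ∈ s, ∀ y ∈ s, ‖y‖ ≤ ‖x‖ → y = x := by
  obtain ⟨x, hx, hdist⟩ := hs.exists_infDist_eq_dist hne 0
  have hmin (y) (hy : y ∈ s) : ‖x‖ ≤ ‖y‖ := by
    simpa [hdist] using Metric.infDist_le_dist_of_mem (x := 0) hy
  refine ⟨x, hx, fun y hy hyx => ?_⟩
  by_contra hxy
  refine (hmin _ ?_).not_gt (((norm_midpoint_lt_iff (hyx.antisymm (hmin y hy))).2 hxy).trans_le hyx)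
  rw [smul_add]
  exact hconv hy hx (by norm_num) (by norm_num) (by norm_num)

theorem exists_measurable_selection_of_convex {E : Type*} [NormedAddCommGroup E] [NormedSpace ℝ E]
    [FiniteDimensional ℝ E] [MeasurableSpace E] [BorelSpace E] {G : Set (α × E)} (hG : IsClosed G)
    (hne : ∀ v, {x | (v, x) ∈ G}.Nonempty) (hconv : ∀ v, Convex ℝ {x | (v, x) ∈ G}) :
    ∃ f : α → E, Measurable f ∧ ∀ v, (v, f v) ∈ G := by
  -- A strictly convex norm makes the point of each section nearest to the origin unique.
  let e := (toEuclidean (E := E)).symm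
  have hGe : IsClosed {p : α × _ | (p.1, e p.2) ∈ G} := hG.preimage (by fun_prop)
  have hnearest (v : α) := exists_unique_nearest_of_convex (s := {x | (v, e x) ∈ G})
    (hG.preimage (by fun_prop)) ((hne v).preimage e.surjective)
    ((hconv v).linear_preimage e.toLinearMap)
  choose f hf hmin using hnearest
  refine ⟨fun v => e (f v), e.continuous.measurable.comp ?_, hf⟩
  refine measurable_of_unique_nearest hGe hf (x₀ := 0) fun v x hx hle => hmin v x hx ?_
  rw [edist_zero_left, edist_zero_left] at hle
  exact_mod_cast hle

theorem exists_measurable_best_approximation {E : Type*} [NormedAddCommGroup E] [NormedSpace ℝ E]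
    [FiniteDimensional ℝ E] [MeasurableSpace E] [BorelSpace E] (M : Submodule ℝ E) :
    ∃ f : E → E, Measurable f ∧ ∀ v, f v ∈ M ∧ ∀ d ∈ M, ‖v + f v‖ ≤ ‖v + d‖ := by
  have : ProperSpace E := FiniteDimensional.proper ℝ E
  have hM : IsClosed (M : Set E) := M.closed_of_finiteDimensional
  refine exists_measurable_selection_of_convex
    (G := {p | p.2 ∈ M ∧ ∀ d ∈ M, ‖p.1 + p.2‖ ≤ ‖p.1 + d‖}) ?_ (fun v => ?_) fun v => ?_
  · simp only [ofPred_and, ofPred_forall]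
    exact (hM.preimage continuous_snd).inter <| isClosed_iInter fun d => isClosed_iInter fun _ =>
      isClosed_le (by fun_prop) (by fun_prop)
  · obtain ⟨x, hx, hdist⟩ := hM.exists_infDist_eq_dist ⟨0, M.zero_mem⟩ (-v)
    refine ⟨x, hx, fun d hd => ?_⟩
    have h := Metric.infDist_le_dist_of_mem (x := -v) (show d ∈ (M : Set E) from hd)
    rwa [hdist, dist_comm, dist_comm _ d, dist_eq_norm, dist_eq_norm, sub_neg_eq_add,
      sub_neg_eq_add, add_comm x, add_comm d] at h
  · convert M.convex.inter (convex_iInter₂ fun d (_ : d ∈ M) => convex_closedBall (-v) ‖v + d‖)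
    ext x
    simp [dist_eq_norm, add_comm]

end Selection

section ModifiedCosts

/-- The real subspace of the self-adjoint elements that commute with `a`: at each time, the
corrections allowed in the modified cost of the state `a`. -/
def selfAdjointCommutant {A : Type*} [Ring A] [StarRing A] [Algebra ℝ A] [StarModule ℝ A] (a : A) :
    Submodule ℝ A where
  carrier := {d | IsSelfAdjoint d ∧ Commute d a}
  add_mem' h₁ h₂ := ⟨h₁.1.add h₂.1, h₁.2.add_left h₂.2⟩
  zero_mem' := ⟨.zero _, .zero_left _⟩
  smul_mem' c _ h := ⟨(IsSelfAdjoint.all c).smul h.1, h.2.smul_left c⟩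

theorem map_mem_selfAdjointCommutant {A B F : Type*} [Ring A] [StarRing A] [Algebra ℝ A]
    [StarModule ℝ A] [Ring B] [StarRing B] [Algebra ℝ B] [StarModule ℝ B] [FunLike F A B]
    [MulHomClass F A B] [StarHomClass F A B] (φ : F) {a d : A} (hd : d ∈ selfAdjointCommutant a) :
    φ d ∈ selfAdjointCommutant (φ a) :=
  ⟨hd.1.map φ, hd.2.map φ⟩

theorem norm_add_map_le_of_forall_norm_add_le {A B : Type*} [CStarAlgebra A] [CStarAlgebra B]
    (φ : A ≃⋆ₐ[ℂ] B) {a d : A} {v e : B}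
    (hd : ∀ e ∈ selfAdjointCommutant a, ‖φ.symm v + d‖ ≤ ‖φ.symm v + e‖)
    (he : e ∈ selfAdjointCommutant (φ a)) : ‖v + φ d‖ ≤ ‖v + e‖ := by
  have hmem : φ.symm e ∈ selfAdjointCommutant a := by
    simpa only [StarAlgEquiv.symm_apply_apply] using map_mem_selfAdjointCommutant φ.symm he
  have hle := hd _ hmem
  rwa [← StarAlgEquiv.norm_map φ, ← StarAlgEquiv.norm_map φ (_ + φ.symm e), map_add, map_add,
    φ.apply_symm_apply, φ.apply_symm_apply] at hle

variable {H : Type*} [NormedAddCommGroup H] [InnerProductSpace ℂ H] [CompleteSpace H] {T : ℝ}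
  {V U : ℝ → H →L[ℂ] H}

theorem integral_norm_mem_modifiedCosts (T : ℝ) (V r : ℝ → H →L[ℂ] H) :
    ∫ t in (0 : ℝ)..T, ‖V t‖ ∈ modifiedCosts T V r :=
  ⟨fun _ => 0, isHamiltonian_const (.zero _) T, fun _ _ => .zero_left _, by simp⟩

variable [FiniteDimensional ℂ H]

theorem aestronglyMeasurable_conj_comp {f : (H →L[ℂ] H) → H →L[ℂ] H} (hf : Measurable f)
    {μ : Measure ℝ} (hU : AEStronglyMeasurable U μ) (hV : AEStronglyMeasurable V μ) :
    AEStronglyMeasurable (fun t => U t * f (star (U t) * V t * U t) * star (U t)) μ := by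
  have : FiniteDimensional ℝ (H →L[ℂ] H) := FiniteDimensional.complexToReal _
  have hUs : AEStronglyMeasurable (fun t => star (U t)) μ :=
    continuous_star.comp_aestronglyMeasurable hU
  exact (hU.mul (hf.comp_aemeasurable
    ((hUs.mul hV).mul hU).aemeasurable).aestronglyMeasurable).mul hUs

theorem IsPropagator.exists_isHamiltonian_forall_norm_add_le (hU : IsPropagator T V U)
    (hV : IsHamiltonian T V) (hT : 0 ≤ T) (ρ : H →L[ℂ] H) :
    ∃ D, IsHamiltonian T D ∧ ∀ t ∈ Icc 0 T, D t ∈ selfAdjointCommutant (state U ρ t) ∧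
      ∀ E ∈ selfAdjointCommutant (state U ρ t), ‖V t + D t‖ ≤ ‖V t + E‖ := by
  have : FiniteDimensional ℝ (H →L[ℂ] H) := FiniteDimensional.complexToReal _
  obtain ⟨f, hf, hbest⟩ := exists_measurable_best_approximation (selfAdjointCommutant ρ)
  -- In the frame rotating with `U` the state is constantly `ρ`, so one selection serves all times.
  let D (t : ℝ) := U t * f (star (U t) * V t * U t) * star (U t)
  have hD (t : ℝ) (ht : t ∈ Icc 0 T) : D t ∈ selfAdjointCommutant (state U ρ t) ∧
      ∀ E ∈ selfAdjointCommutant (state U ρ t), ‖V t + D t‖ ≤ ‖V t + E‖ := by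
    let φ := Unitary.conjStarAlgAut ℂ (H →L[ℂ] H) ⟨U t, hU.mem_unitary hV ht⟩
    obtain ⟨hmem, hmin⟩ := hbest (φ.symm (V t))
    exact ⟨map_mem_selfAdjointCommutant φ hmem,
      fun E hE => norm_add_map_le_of_forall_norm_add_le φ hmin hE⟩
  have hDV (t : ℝ) (ht : t ∈ Icc 0 T) : ‖D t‖ ≤ 2 * ‖V t‖ := by
    have hle := (hD t ht).2 0 (Submodule.zero_mem _)
    rw [add_zero] at hle
    linarith [norm_le_add_norm_add' (V t) (D t)]
  refine ⟨D, ⟨fun t ht => (hD t ht).1.1, ?_⟩, hD⟩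
  rw [intervalIntegrable_iff_integrableOn_Ioc_of_le hT]
  have hVint := (intervalIntegrable_iff_integrableOn_Ioc_of_le hT).1 hV.integrable
  refine (hVint.norm.const_mul 2).mono' (aestronglyMeasurable_conj_comp hf ?_ hVint.1) ?_
  · exact (hU.continuousOn.mono Ioc_subset_Icc_self).aestronglyMeasurable measurableSet_Ioc
  · exact ae_restrict_of_forall_mem measurableSet_Ioc fun t ht => hDV t (Ioc_subset_Icc_self ht)

theorem IsPropagator.exists_isLeast_modifiedCosts (hU : IsPropagator T V U)
    (hV : IsHamiltonian T V) (hT : 0 ≤ T) (ρ : H →L[ℂ] H) :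
    ∃ c, IsLeast (modifiedCosts T V (state U ρ)) c := by
  obtain ⟨D, hD, hbest⟩ := hU.exists_isHamiltonian_forall_norm_add_le hV hT ρ
  refine ⟨_, ⟨D, hD, fun t ht => (hbest t ht).1.2, rfl⟩, ?_⟩
  rintro _ ⟨E, hE, hcomm, rfl⟩
  exact intervalIntegral.integral_mono_on hT (hV.integrable.add hD.integrable).norm
    (hV.integrable.add hE.integrable).norm
    fun t ht => (hbest t ht).2 (E t) ⟨hE.selfAdjoint t ht, hcomm t ht⟩

end ModifiedCosts

section SpeedLimits

variable {H : Type*} [NormedAddCommGroup H] [InnerProductSpace ℂ H]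

theorem IsDensity.nontrivial {ρ : H →L[ℂ] H} (hρ : IsDensity ρ) : Nontrivial H := by
  by_contra h
  rw [not_nontrivial_iff_subsingleton] at h
  simpa [Subsingleton.elim (ρ : H →ₗ[ℂ] H) 0] using hρ.trace_one

theorem mul_vCD {T : ℝ} (hT : T ≠ 0) (V : ℝ → H →L[ℂ] H) :
    T * vCD T V = ∫ t in (0 : ℝ)..T, ‖V t‖ := by
  rw [vCD, ← mul_assoc, mul_one_div_cancel hT, one_mul]

variable [CompleteSpace H] {ρ σ A : H →L[ℂ] H} {T : ℝ} {V U : ℝ → H →L[ℂ] H}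

theorem mul_vmCD (hT : T ≠ 0) (V r : ℝ → H →L[ℂ] H) :
    T * vmCD T V r = sInf (modifiedCosts T V r) := by
  rw [vmCD, ← mul_assoc, mul_one_div_cancel hT, one_mul]

theorem tCD_eq_of_chargingDistance_eq_integral (hT : T ≠ 0) (hne : chargingDistance ρ σ ≠ 0)
    (h : chargingDistance ρ σ = ∫ t in (0 : ℝ)..T, ‖V t‖) : tCD T V ρ σ = T := by
  rw [← mul_vCD hT] at h
  rw [tCD, div_eq_iff (right_ne_zero_of_mul (h ▸ hne)), h]

theorem tCD_le_tmCD {r : ℝ → H →L[ℂ] H} (hd : 0 ≤ chargingDistance ρ σ) (hT : 0 < T)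
    (hle : chargingDistance ρ σ ≤ T * vmCD T V r) (hv : vmCD T V r ≤ vCD T V) :
    tCD T V ρ σ ≤ tmCD T V r ρ σ := by
  obtain hd0 | hd0 := hd.eq_or_lt
  · rw [tCD, tmCD, ← hd0, zero_div, zero_div]
  · exact div_le_div_of_nonneg_left hd (pos_of_mul_pos_right (hd0.trans_le hle) hT.le) hv

theorem vmCD_le_vCD {r : ℝ → H →L[ℂ] H} (hT : 0 < T)
    (h : IsLeast (modifiedCosts T V r) (T * vmCD T V r)) : vmCD T V r ≤ vCD T V := by
  refine le_of_mul_le_mul_left ?_ hT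
  rw [mul_vCD hT.ne']
  exact h.2 (integral_norm_mem_modifiedCosts T V r)

variable [FiniteDimensional ℂ H]

theorem IsPropagator.isLeast_modifiedCosts_mul_vmCD (hU : IsPropagator T V U)
    (hV : IsHamiltonian T V) (hT : 0 < T) (ρ : H →L[ℂ] H) :
    IsLeast (modifiedCosts T V (state U ρ)) (T * vmCD T V (state U ρ)) := by
  obtain ⟨c, hc⟩ := hU.exists_isLeast_modifiedCosts hV hT.le ρ
  rwa [mul_vmCD hT.ne', hc.csInf_eq]

end SpeedLimits

end QuantumCharging

end

open MeasureTheory Set QuantumCharging in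
theorem mainTheorem9_general {H : Type*} [NormedAddCommGroup H] [InnerProductSpace ℂ H]
    [CompleteSpace H] [FiniteDimensional ℂ H] [Nontrivial H] (ρ σ : H →L[ℂ] H)
    (T : ℝ) (hT : 0 < T) (V U : ℝ → H →L[ℂ] H)
    (hV : IsHamiltonian T V) (hU : IsPropagator T V U) (hσ : state U ρ T = σ) :
    IsLeast (chargingTimes ρ σ) (chargingDistance ρ σ) ∧
    IsLeast (modifiedCosts T V (state U ρ)) (T * vmCD T V (state U ρ)) ∧
    chargingDistance ρ σ ≤ T * vmCD T V (state U ρ) ∧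
    tmCD T V (state U ρ) ρ σ ≤ T ∧
    chargingDistance ρ σ ≤ ∫ t in (0 : ℝ)..T, ‖V t‖ ∧
    tCD T V ρ σ ≤ T ∧
    tCD T V ρ σ ≤ tmCD T V (state U ρ) ρ σ ∧
    (∀ T' : ℝ, 0 < T' → ∃ V' U' : ℝ → H →L[ℂ] H,
      IsHamiltonian T' V' ∧ IsPropagator T' V' U' ∧ state U' ρ T' = σ ∧
      chargingDistance ρ σ = ∫ t in (0 : ℝ)..T', ‖V' t‖ ∧
      (ρ ≠ σ → tCD T' V' ρ σ = T')) := by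
  subst hσ
  have hcosts := hU.isLeast_modifiedCosts_mul_vmCD hV hT ρ
  obtain ⟨B, hB, hBcost⟩ := hU.exists_mem_generators_of_mem_modifiedCosts hV hT.le hcosts.1
  obtain ⟨A, hA, hleast, hmin⟩ := exists_mem_generators_isLeast_norm ⟨B, hB⟩
  have hdist : chargingDistance ρ (state U ρ T) = ‖A‖ := hleast.csInf_eq
  have hspeed : chargingDistance ρ (state U ρ T) ≤ T * vmCD T V (state U ρ) :=
    hdist.trans_le ((hmin B hB).trans hBcost)
  have hnonneg : 0 ≤ chargingDistance ρ (state U ρ T) := hdist ▸ norm_nonneg A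
  have hv := vmCD_le_vCD hT hcosts
  have htm : tmCD T V (state U ρ) ρ (state U ρ T) ≤ T :=
    div_le_of_le_mul₀ (nonneg_of_mul_nonneg_right (hnonneg.trans hspeed) hT) hT.le hspeed
  have ht := tCD_le_tmCD hnonneg hT hspeed hv
  refine ⟨hdist ▸ hleast, hcosts, hspeed, htm, ?_, ht.trans htm, ht, fun T' hT' => ?_⟩
  · exact hspeed.trans (hcosts.2 (integral_norm_mem_modifiedCosts T V _))
  · obtain ⟨V', U', hV', hU', hσ', hcost⟩ := exists_evolution_integral_norm_eq hA hT'
    refine ⟨V', U', hV', hU', hσ', hdist.trans hcost.symm, fun hne => ?_⟩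
    refine tCD_eq_of_chargingDistance_eq_integral hT'.ne' ?_ (hdist.trans hcost.symm)
    rw [hdist]
    exact norm_ne_zero_iff.2 fun h0 => hne (eq_of_zero_mem_generators (h0 ▸ hA))

open MeasureTheory Set QuantumCharging in
theorem mainTheorem9 {H : Type*} [NormedAddCommGroup H] [InnerProductSpace ℂ H]
    [CompleteSpace H] [FiniteDimensional ℂ H]
    (ρ σ : H →L[ℂ] H) (hρ : IsDensity ρ)
    (T : ℝ) (hT : 0 < T) (V U : ℝ → H →L[ℂ] H)
    (hV : IsHamiltonian T V) (hU : IsPropagator T V U) (hσ : state U ρ T = σ) :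
    -- the minimum that defines `D(ρ, σ)` is attained
    IsLeast (chargingTimes ρ σ) (chargingDistance ρ σ) ∧
    -- the minimum that defines `v_mCD` is attained
    IsLeast (modifiedCosts T V (state U ρ)) (T * vmCD T V (state U ρ)) ∧
    -- the modified speed limit
    chargingDistance ρ σ ≤ T * vmCD T V (state U ρ) ∧
    tmCD T V (state U ρ) ρ σ ≤ T ∧
    -- the weaker speed limit
    chargingDistance ρ σ ≤ ∫ t in (0 : ℝ)..T, ‖V t‖ ∧
    tCD T V ρ σ ≤ T ∧
    tCD T V ρ σ ≤ tmCD T V (state U ρ) ρ σ ∧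
    -- the weaker speed limit is achievable, with any prescribed duration
    (∀ T' : ℝ, 0 < T' → ∃ V' U' : ℝ → H →L[ℂ] H,
      IsHamiltonian T' V' ∧ IsPropagator T' V' U' ∧ state U' ρ T' = σ ∧
      chargingDistance ρ σ = ∫ t in (0 : ℝ)..T', ‖V' t‖ ∧
      (ρ ≠ σ → tCD T' V' ρ σ = T')) := by
  have := hρ.nontrivial
  exact mainTheorem9_general ρ σ T hT V U hV hU hσ
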